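/- Let $R$ be an associative ring with unit, and consider classes of right $R$-modules. Given a class $\mathcal G$ of right $R$-modules, a $\mathcal G$-filtration of a right $R$-module $M$ is a chain of submodules $(G_\alpha : \alpha<\kappa)$ of $M$, indexed by the ordinals $\alpha$ below a cardinal $\kappa$, such that $G_0=0$, $G_\alpha\subseteq G_\beta$ for $\alpha\le\beta<\kappa$, $G_\beta=\bigcup_{\alpha<\beta}G_\alpha$ for each limit ordinal $\beta<\kappa$, $M=\bigcup_{\alpha<\kappa}G_\alpha$, and $G_{\alpha+1}/G_\alpha$ is isomorphic to a module in $\mathcal G$ whenever $\alpha+1<\kappa$. (The zero module is regarded as $\mathcal G$-filtered for every $\mathcal G$.) Let $\operatorname{Filt}\text{-}\mathcal G$ be the class of all modules that have a $\mathcal G$-filtration. A class $\mathcal X$ of right $R$-modules is called deconstructible if $\mathcal X=\operatorname{Filt}\text{-}\mathcal G$ for some set $\mathcal G$ of right $R$-modules. It is called preenveloping if every right $R$-module $M$ has an $\mathcal X$-preenvelope, that is, a morphism $f:M\to X$ with $X\in\mathcal X$ such that for every $X'\in\mathcal X$ the map $\operatorname{Hom}_R(X,X')\to\operatorname{Hom}_R(M,X')$,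 $h\mapsto hf$, is surjective. **Theorem.** Every deconstructible class of right $R$-modules that is closed under arbitrary direct products is preenveloping. -/

import Mathlib

open CategoryTheory

universe u

/-- Right `R`-modules are the modules over the opposite ring. -/
abbrev RightMod (R : Type u) [Ring R] := ModuleCat.{u} Rᵐᵒᵖ

/-- `F` (restricted to the ordinals below `κ`) is a `𝒢`-filtration of `M`: a continuous chain
of submodules starting at `0`, with union `M`, and whose consecutive quotients are
(isomorphic to) modules in `𝒢`. The ordinals `α < κ` are those below the initial ordinal of
`κ`. The supremum of a chain of submodules is its union. -/
structure IsFiltrationBy {R : Type u} [Ring R] (𝒢 : Set (RightMod R)) (M : RightMod R)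
    (κ : Cardinal.{u}) (F : Ordinal.{u} → Submodule Rᵐᵒᵖ M) : Prop where
  zero : F 0 = ⊥
  mono : ∀ α β : Ordinal.{u}, α ≤ β → β < κ.ord → F α ≤ F β
  limit : ∀ β : Ordinal.{u}, Order.IsSuccLimit β → β < κ.ord →
    F β = ⨆ α : Set.Iio β, F α
  quotient : ∀ α : Ordinal.{u}, α + 1 < κ.ord →
    ∃ N ∈ 𝒢, Nonempty ((F (α + 1) ⧸ (F α).submoduleOf (F (α + 1))) ≃ₗ[Rᵐᵒᵖ] N)
  union : ⨆ α : Set.Iio κ.ord, F α = ⊤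

/-- The class of all `𝒢`-filtered modules. -/
def Filt {R : Type u} [Ring R] (𝒢 : Set (RightMod R)) : Set (RightMod R) :=
  {M | ∃ (κ : Cardinal.{u}) (F : Ordinal.{u} → Submodule Rᵐᵒᵖ M), IsFiltrationBy 𝒢 M κ F}

/-- A class of modules is deconstructible if it consists exactly of the modules filtered by
some set of modules. A class (here a `Set` of objects of the large category of modules) is a
set in the sense of set theory if it is `u`-small. -/
def IsDeconstructible {R : Type u} [Ring R] (𝒳 : Set (RightMod R)) : Prop :=
  ∃ 𝒢 : Set (RightMod R), Small.{u} 𝒢 ∧ 𝒳 = Filt 𝒢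

/-- Closure under arbitrary (set-indexed) direct products. -/
def IsClosedUnderProducts {R : Type u} [Ring R] (𝒳 : Set (RightMod R)) : Prop :=
  ∀ (ι : Type u) (X : ι → RightMod R), (∀ i, X i ∈ 𝒳) →
    ModuleCat.of Rᵐᵒᵖ (∀ i, X i) ∈ 𝒳

/-- `f : M ⟶ X` is an `𝒳`-preenvelope of `M`: `X ∈ 𝒳`, and `Hom(X, X') → Hom(M, X')` is
surjective for every `X' ∈ 𝒳`. -/
def IsPreenvelope {R : Type u} [Ring R] (𝒳 : Set (RightMod R)) {M X : RightMod R}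
    (f : M ⟶ X) : Prop :=
  X ∈ 𝒳 ∧ ∀ X' ∈ 𝒳, Function.Surjective (fun h : X ⟶ X' => f ≫ h)

/-- Every right module has an `𝒳`-preenvelope. -/
def IsPreenveloping {R : Type u} [Ring R] (𝒳 : Set (RightMod R)) : Prop :=
  ∀ M : RightMod R, ∃ (X : RightMod R) (f : M ⟶ X), IsPreenvelope 𝒳 f

open Cardinal Ordinal Set

/-! Let `c` be a regular uncountable cardinal exceeding the sizes of `R`, `M` and all members of
`𝒢`. It suffices to factor every map from `M` to a filtered `X` through a filtered submodule with at
most `c` generators: up to isomorphism such modules form a set, and the product of all of them, one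
copy for each map from `M`, is a preenvelope.

The submodule comes from a Hill-type argument (`exists_filtered_submodule`). The filtration is
written as partial sums of small submodules `B i`. The elements of `B i` in the earlier sum already
lie in the sum over a set `S i` of fewer than `c` earlier indices. Over an index set closed under
`S`, the sum is filtered with the same quotients (`IsClosedIndexSet.mem_inter`). Since the length
must be a cardinal, the closed set is taken of size exactly `c` and rearranged in order type `c.ord`
(`exists_reorder`). -/

/-! ### Reordering a well-ordered index set -/

/-- The set of all elements that are reached from `i` by repeatedly passing from an element `x`
to an element of `S x`. -/
def reachable {I : Type u} (S : I → Set I) (i : I) : Set I :=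
  {j | Relation.ReflTransGen (fun x y => y ∈ S x) i j}

theorem self_mem_reachable {I : Type u} (S : I → Set I) (i : I) : i ∈ reachable S i :=
  Relation.ReflTransGen.refl

theorem reachable_closed {I : Type u} {S : I → Set I} {i j k : I}
    (hj : j ∈ reachable S i) (hk : k ∈ S j) : k ∈ reachable S i :=
  Relation.ReflTransGen.tail hj hk

theorem mk_reachable_lt {I : Type u} [LinearOrder I] [WellFoundedLT I] {c : Cardinal.{u}}
    (hc : c.IsRegular) {S : I → Set I} (hlt : ∀ i, ∀ j ∈ S i, j < i) (hS : ∀ i, #(S i) < c)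
    (i : I) : #(reachable S i) < c := by
  induction i using WellFoundedLT.induction with
  | ind i ih =>
    have hsub : reachable S i ⊆ {i} ∪ ⋃ j ∈ S i, reachable S j := by
      intro k hk
      rcases Relation.ReflTransGen.cases_head hk with h | ⟨j, hj, hjk⟩
      · exact Or.inl h.symm
      · exact Or.inr (mem_biUnion hj hjk)
    refine (mk_le_mk_of_subset hsub).trans_lt ((mk_union_le _ _).trans_lt ?_)
    refine add_lt_of_lt hc.aleph0_le ?_ ?_
    · rw [mk_singleton]
      exact one_lt_aleph0.trans_le hc.aleph0_le
    · exact (card_biUnion_lt_iff_forall_of_isRegular (t := fun j _ => reachable S j) hc (hS i)).2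
        fun j hj => ih j (hlt i j hj)

/-- A well-ordered set of regular cardinality `c`, with a relation `j ∈ S i` implying `j < i` and
with all `S i` of cardinality less than `c`, can be reordered in order type `c.ord` so that the
members of `S i` still precede `i`. -/
theorem exists_reorder {I : Type u} [LinearOrder I] [WellFoundedLT I] {c : Cardinal.{u}}
    (hc : c.IsRegular) {S : I → Set I} (hlt : ∀ i, ∀ j ∈ S i, j < i) (hS : ∀ i, #(S i) < c)
    (hI : #I = c) :
    ∃ e : I → Ordinal.{u}, Function.Injective e ∧ (∀ i, e i < c.ord) ∧
      (∀ o < c.ord, ∃ i, e i = o) ∧ ∀ i, ∀ j ∈ S i, e j < e i := by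
  obtain ⟨r⟩ : Nonempty (I ≃ c.ord.ToType) := by
    rw [← Cardinal.eq, hI, mk_ord_toType]
  let T : I → Set c.ord.ToType := fun a => {x | a ∈ reachable S (r.symm x)}
  have hT : ∀ a, (T a).Nonempty := fun a => ⟨r a, by simp [T, self_mem_reachable]⟩
  -- Sorting by the first stage whose closure contains `a`, then by the old order, puts fewer than
  -- `c` elements before each `a` by regularity. Passing to `S` never raises the stage and lowers
  -- the old order.
  let lvl : I → c.ord.ToType := fun a => wellFounded_lt.min (T a) (hT a)
  have hlvl : ∀ a, a ∈ reachable S (r.symm (lvl a)) := fun a => wellFounded_lt.min_mem (T a) (hT a)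
  have hlvl_le : ∀ a x, a ∈ reachable S (r.symm x) → lvl a ≤ x := fun a x h =>
    not_lt.1 (wellFounded_lt.not_lt_min (T a) (x := x) h)
  let key : I ↪ c.ord.ToType ×ₗ I := ⟨fun a => toLex (lvl a, a), fun a b h => by
    have := congrArg (fun z => (ofLex z).2) h
    exact this⟩
  let ρ : I → I → Prop := key ⁻¹'o (· < ·)
  have : IsWellOrder I ρ := (RelEmbedding.preimage key (· < ·)).isWellOrder
  have hρ : ∀ a b, ρ a b ↔ lvl a < lvl b ∨ lvl a = lvl b ∧ a < b := fun a b => Prod.Lex.lt_iff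
  refine ⟨fun a => typein ρ a, typein_injective ρ, fun a => ?_, fun o ho => ?_, fun i j hj => ?_⟩
  · rw [lt_ord, card_typein]
    have hsub : {y | ρ y a} ⊆ ⋃ x ∈ Iic (lvl a), reachable S (r.symm x) := by
      intro y hy
      refine mem_biUnion (x := lvl y) ?_ (hlvl y)
      rcases (hρ y a).1 hy with h | h
      · exact h.le
      · exact h.1.le
    refine (mk_le_mk_of_subset hsub).trans_lt ?_
    have hIic : #(Iic (lvl a)) < c := by
      rw [← Iio_insert]
      refine (mk_insert_le).trans_lt (add_lt_of_lt hc.aleph0_le (by simpa using mk_Iio_lt (lvl a) (by simp)) ?_)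
      exact one_lt_aleph0.trans_le hc.aleph0_le
    exact (card_biUnion_lt_iff_forall_of_isRegular
      (t := fun x _ => reachable S (r.symm x)) hc hIic).2 fun x _ => mk_reachable_lt hc hlt hS _
  · refine typein_surj ρ (ho.trans_le ?_)
    rw [ord_le, card_type, hI]
  · refine (typein_lt_typein ρ).2 ((hρ j i).2 ?_)
    rcases (hlvl_le j (lvl i) (reachable_closed (hlvl i) hj)).lt_or_eq with h | h
    · exact Or.inl h
    · exact Or.inr ⟨h, hlt i j hj⟩

/-! ### Quotients, and sums over closed index sets -/

section FilteredSums

variable {A : Type u} [Ring A]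

/-- The quotient `P / (P ∩ Q)` is isomorphic to a module in `𝒢`. -/
def HasQuotientIn (𝒢 : Set (ModuleCat.{u} A)) {M : Type u} [AddCommGroup M] [Module A M]
    (P Q : Submodule A M) : Prop :=
  ∃ N ∈ 𝒢, ∃ f : P →ₗ[A] N, Function.Surjective f ∧ ∀ x, f x = 0 ↔ (x : M) ∈ Q

variable {𝒢 : Set (ModuleCat.{u} A)} {M : Type u} [AddCommGroup M] [Module A M]

theorem hasQuotientIn_iff {P Q : Submodule A M} :
    HasQuotientIn 𝒢 P Q ↔ ∃ N ∈ 𝒢, Nonempty ((P ⧸ Q.submoduleOf P) ≃ₗ[A] N) := by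
  constructor
  · rintro ⟨N, hN, f, hf, hker⟩
    have h : Q.submoduleOf P = LinearMap.ker f := by
      ext x
      rw [LinearMap.mem_ker, hker]
      rfl
    exact ⟨N, hN, ⟨(Submodule.quotEquivOfEq _ _ h).trans (f.quotKerEquivOfSurjective hf)⟩⟩
  · rintro ⟨N, hN, ⟨e⟩⟩
    refine ⟨N, hN, e.toLinearMap ∘ₗ (Q.submoduleOf P).mkQ,
      e.surjective.comp (Submodule.mkQ_surjective _), fun x => ?_⟩
    rw [LinearMap.comp_apply, LinearEquiv.coe_coe, e.map_eq_zero_iff, Submodule.mkQ_apply,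
      Submodule.Quotient.mk_eq_zero]
    rfl

theorem HasQuotientIn.congr {P Q Q' : Submodule A M} (h : HasQuotientIn 𝒢 P Q)
    (hQ : ∀ x ∈ P, x ∈ Q ↔ x ∈ Q') : HasQuotientIn 𝒢 P Q' := by
  obtain ⟨N, hN, f, hf, hker⟩ := h
  exact ⟨N, hN, f, hf, fun x => (hker x).trans (hQ x x.2)⟩

theorem HasQuotientIn.of_sup {P Q : Submodule A M} (h : HasQuotientIn 𝒢 (P ⊔ Q) Q) :
    HasQuotientIn 𝒢 P Q := by
  obtain ⟨N, hN, f, hf, hker⟩ := h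
  refine ⟨N, hN, f ∘ₗ Submodule.inclusion le_sup_left, fun n => ?_, fun x => hker _⟩
  obtain ⟨⟨x, hx⟩, rfl⟩ := hf n
  obtain ⟨p, hp, q, hq, rfl⟩ := Submodule.mem_sup.1 hx
  refine ⟨⟨p, hp⟩, ?_⟩
  have hq0 : f ⟨q, Submodule.mem_sup_right hq⟩ = 0 := (hker _).2 hq
  rw [LinearMap.comp_apply, ← add_zero (f _), ← hq0, ← map_add]
  rfl

theorem HasQuotientIn.sup {P Q : Submodule A M} (h : HasQuotientIn 𝒢 P Q) :
    HasQuotientIn 𝒢 (P ⊔ Q) Q := by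
  obtain ⟨N, hN, ⟨e⟩⟩ := hasQuotientIn_iff.1 h
  have hPQ : Submodule.comap P.subtype P ⊓ Submodule.comap P.subtype Q = Q.submoduleOf P := by
    simp [Submodule.submoduleOf]
  exact hasQuotientIn_iff.2 ⟨N, hN, ⟨(LinearMap.quotientInfEquivSupQuotient P Q).symm.trans
    ((Submodule.quotEquivOfEq _ _ hPQ).trans e)⟩⟩

theorem HasQuotientIn.comap_subtype {P Q Y : Submodule A M} (h : HasQuotientIn 𝒢 P Q)
    (hP : P ≤ Y) {Z : Submodule A Y} (hZ : ∀ x : Y, x ∈ Z ↔ (x : M) ∈ Q) :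
    HasQuotientIn 𝒢 (P.submoduleOf Y) Z := by
  obtain ⟨N, hN, f, hf, hker⟩ := h
  exact ⟨N, hN, f ∘ₗ (Submodule.submoduleOfEquivOfLe hP).toLinearMap,
    hf.comp (LinearEquiv.surjective _), fun x => (hker _).trans (hZ _).symm⟩

theorem mk_span_lt {c : Cardinal.{u}} (hc : ℵ₀ < c) (hA : #A < c) {s : Set M} (hs : #s < c) :
    #(Submodule.span A s) < c := by
  have h1 : #(Submodule.span A s) ≤ #(s →₀ A) := by
    rw [Finsupp.span_eq_range_linearCombination]
    exact mk_range_le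
  have h2 : #(s →₀ A) ≤ #(Finset (s × A)) := mk_le_of_injective (Finsupp.graph_injective _ _)
  refine (h1.trans h2).trans_lt ?_
  rcases finite_or_infinite (s × A) with h | h
  · exact (lt_aleph0_of_finite _).trans hc
  · rw [mk_finset_of_infinite, mk_prod, Cardinal.lift_id, Cardinal.lift_id]
    exact mul_lt_of_lt hc.le hs hA

/-- Lifts to `P` of all elements of `N` span a suitable `B`. -/
theorem HasQuotientIn.exists_small {c : Cardinal.{u}} (hc : ℵ₀ < c) (hA : #A < c)
    (h𝒢 : ∀ N ∈ 𝒢, #N < c) {P Q : Submodule A M} (hQP : Q ≤ P) (h : HasQuotientIn 𝒢 P Q) :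
    ∃ B : Submodule A M, #B < c ∧ B ⊔ Q = P ∧ HasQuotientIn 𝒢 B Q := by
  obtain ⟨N, hN, f, hf, hker⟩ := h
  let s : Set M := range fun n : N => ((Function.surjInv hf n : P) : M)
  have hsP : Submodule.span A s ≤ P := by
    rw [Submodule.span_le]
    rintro _ ⟨n, rfl⟩
    exact Subtype.prop _
  have hsup : Submodule.span A s ⊔ Q = P := by
    refine le_antisymm (sup_le hsP hQP) fun x hx => ?_
    have hmem : ((Function.surjInv hf (f ⟨x, hx⟩) : P) : M) ∈ Submodule.span A s :=
      Submodule.subset_span ⟨f ⟨x, hx⟩, rfl⟩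
    have hdiff : x - ((Function.surjInv hf (f ⟨x, hx⟩) : P) : M) ∈ Q := by
      refine (hker (⟨x, hx⟩ - Function.surjInv hf (f ⟨x, hx⟩))).1 ?_
      rw [map_sub, Function.surjInv_eq hf]
      exact sub_self _
    exact Submodule.mem_sup.2 ⟨_, hmem, _, hdiff, by abel⟩
  refine ⟨_, mk_span_lt hc hA (mk_range_le.trans_lt (h𝒢 N hN)), hsup, HasQuotientIn.of_sup ?_⟩
  rw [hsup]
  exact ⟨N, hN, f, hf, hker⟩

variable {I : Type u}

/-- The sum of the submodules `B i` with `i ∈ D`. -/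
def partialSum (B : I → Submodule A M) (D : Set I) : Submodule A M := ⨆ i ∈ D, B i

variable {B : I → Submodule A M}

theorem le_partialSum {D : Set I} {i : I} (hi : i ∈ D) : B i ≤ partialSum B D :=
  le_biSup B hi

theorem partialSum_mono {D E : Set I} (h : D ⊆ E) : partialSum B D ≤ partialSum B E :=
  biSup_mono fun _ hi => h hi

theorem mem_partialSum_of_subset {D E : Set I} {x : M} (hx : x ∈ partialSum B D) (h : D ⊆ E) :
    x ∈ partialSum B E :=
  partialSum_mono h hx

theorem mem_partialSum {D : Set I} {i : I} {x : M} (hx : x ∈ B i) (hi : i ∈ D) :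
    x ∈ partialSum B D :=
  le_partialSum hi hx

theorem partialSum_induction {D : Set I} {p : M → Prop} {x : M} (hx : x ∈ partialSum B D)
    (mem : ∀ i ∈ D, ∀ y ∈ B i, p y) (zero : p 0) (add : ∀ y z, p y → p z → p (y + z)) : p x := by
  rw [partialSum, iSup_subtype'] at hx
  exact Submodule.iSup_induction _ (motive := p) hx (fun i y hy => mem i i.2 y hy) zero add

theorem exists_finite_of_mem_partialSum {D : Set I} {x : M} (hx : x ∈ partialSum B D) :
    ∃ t ⊆ D, t.Finite ∧ x ∈ partialSum B t := by
  refine partialSum_induction (p := fun x => ∃ t ⊆ D, t.Finite ∧ x ∈ partialSum B t) hx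
    (fun i hi y hy => ?_) ?_ ?_
  · exact ⟨{i}, by simpa using hi, finite_singleton i, mem_partialSum hy rfl⟩
  · exact ⟨∅, empty_subset _, finite_empty, zero_mem _⟩
  · rintro y z ⟨t, ht, htf, hy⟩ ⟨t', ht', htf', hz⟩
    exact ⟨t ∪ t', union_subset ht ht', htf.union htf',
      add_mem (mem_partialSum_of_subset hy subset_union_left)
        (mem_partialSum_of_subset hz subset_union_right)⟩

theorem exists_small_of_subset_partialSum {c : Cardinal.{u}} (hc : c.IsRegular) {D : Set I}
    {s : Set M} (hs : #s < c) (hsD : s ⊆ partialSum B D) :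
    ∃ t ⊆ D, #t < c ∧ s ⊆ partialSum B t := by
  choose t htD htf ht using fun x : s => exists_finite_of_mem_partialSum (hsD x.2)
  refine ⟨⋃ x, t x, iUnion_subset htD, (card_iUnion_lt_iff_forall_of_isRegular hc hs).2 fun x =>
    (htf x).lt_aleph0.trans_le hc.aleph0_le, fun x hx => ?_⟩
  exact partialSum_mono (subset_iUnion t ⟨x, hx⟩) (ht ⟨x, hx⟩)

section LinearOrder

variable [LinearOrder I]

theorem eq_zero_or_exists_of_mem_partialSum {D : Set I} {x : M} (hx : x ∈ partialSum B D) :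
    x = 0 ∨ ∃ i ∈ D, x ∈ partialSum B (D ∩ Iic i) := by
  refine partialSum_induction (p := fun x => x = 0 ∨ ∃ i ∈ D, x ∈ partialSum B (D ∩ Iic i)) hx
    (fun i hi y hy => ?_) (Or.inl rfl) ?_
  · exact Or.inr ⟨i, hi, mem_partialSum hy ⟨hi, le_rfl⟩⟩
  · rintro y z (rfl | ⟨i, hi, hy⟩) (rfl | ⟨j, hj, hz⟩)
    · exact Or.inl (add_zero 0)
    · exact Or.inr ⟨j, hj, by simpa using hz⟩
    · exact Or.inr ⟨i, hi, by simpa using hy⟩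
    · refine Or.inr ⟨max i j, by rcases max_choice i j with h | h <;> rwa [h], add_mem ?_ ?_⟩
      · exact partialSum_mono (inter_subset_inter_right D (Iic_subset_Iic.2 (le_max_left i j))) hy
      · exact partialSum_mono (inter_subset_inter_right D (Iic_subset_Iic.2 (le_max_right i j))) hz

/-- A set `C` of indices is closed if for `i ∈ C` the elements of `B i` that are sums over the
indices below `i` are already sums over the members of `C` below `i`. -/
def IsClosedIndexSet (B : I → Submodule A M) (C : Set I) : Prop :=
  ∀ i ∈ C, B i ⊓ partialSum B (Iio i) ≤ partialSum B (C ∩ Iio i)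

/-- Induction on an upper bound `k` of the indices used: if `k ∉ L`, the `B k` component of `x` lies
in the sum below `k`, so closedness rewrites it with smaller indices of `C`. -/
theorem IsClosedIndexSet.mem_inter [WellFoundedLT I] {C L : Set I} (hC : IsClosedIndexSet B C)
    (hL : IsLowerSet L) {x : M} (hxC : x ∈ partialSum B C) (hxL : x ∈ partialSum B L) :
    x ∈ partialSum B (C ∩ L) := by
  have key : ∀ k, ∀ x ∈ partialSum B (C ∩ Iic k), x ∈ partialSum B L →
      x ∈ partialSum B (C ∩ L) := by
    intro k
    induction k using WellFoundedLT.induction with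
    | ind k ih =>
      intro x hx hxL
      by_cases hk : k ∈ L
      · exact partialSum_mono (inter_subset_inter_right C fun i hi => hL hi hk) hx
      have hLk : L ⊆ Iio k := fun i hi => not_le.1 fun h => hk (hL h hi)
      have hx' : x ∈ partialSum B (C ∩ Iio k) := by
        by_cases hkC : k ∈ C
        · have hle : partialSum B (C ∩ Iic k) ≤ B k ⊔ partialSum B (C ∩ Iio k) := by
            refine iSup₂_le fun i hi => ?_
            rcases (show i ≤ k from hi.2).lt_or_eq with h | rfl
            · exact (le_partialSum (B := B) (⟨hi.1, h⟩ : i ∈ C ∩ Iio k)).trans le_sup_right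
            · exact le_sup_left
          obtain ⟨a, ha, y, hy, rfl⟩ := Submodule.mem_sup.1 (hle hx)
          refine add_mem (hC k hkC ⟨ha, ?_⟩) hy
          rw [← add_sub_cancel_right a y]
          exact sub_mem (partialSum_mono hLk hxL) (partialSum_mono inter_subset_right hy)
        · refine mem_partialSum_of_subset hx fun i hi => ⟨hi.1, lt_of_le_of_ne hi.2 ?_⟩
          rintro rfl
          exact hkC hi.1
      rcases eq_zero_or_exists_of_mem_partialSum hx' with rfl | ⟨i, hi, hxi⟩
      · exact zero_mem _
      · exact ih i hi.2 x (mem_partialSum_of_subset hxi fun j hj => ⟨hj.1.1, hj.2⟩) hxL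
  rcases eq_zero_or_exists_of_mem_partialSum hxC with rfl | ⟨i, _, hxi⟩
  · exact zero_mem _
  · exact key i x hxi hxL

/-- `B i` meets the sums over `C` and over `Iio i` in the same elements, by
`IsClosedIndexSet.mem_inter` with `L = Iic i`. -/
theorem HasQuotientIn.of_closed [WellFoundedLT I] {C : Set I} (hC : IsClosedIndexSet B C) {i : I}
    (hiC : i ∉ C) (hi : B i ⊓ partialSum B (Iio i) ≤ partialSum B C)
    (h : HasQuotientIn 𝒢 (B i) (partialSum B (Iio i))) :
    HasQuotientIn 𝒢 (B i) (partialSum B C) := by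
  refine h.congr fun x hx => ⟨fun hx' => hi ⟨hx, hx'⟩, fun hx' => ?_⟩
  refine partialSum_mono ?_ (hC.mem_inter (isLowerSet_Iic i) hx' (le_partialSum self_mem_Iic hx))
  refine fun j hj => lt_of_le_of_ne hj.2 ?_
  rintro rfl
  exact hiC hj.1

end LinearOrder

end FilteredSums

/-! ### Filtrations and small filtered submodules -/

section Filtrations

variable {R : Type u} [Ring R] {𝒢 : Set (RightMod R)}

theorem partialSum_lt_add_one {A M J : Type u} [Ring A] [AddCommGroup M] [Module A M]
    {B : J → Submodule A M} {e : J → Ordinal.{u}} (he : Function.Injective e) (j : J) :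
    partialSum B {k | e k < e j + 1} = B j ⊔ partialSum B {k | e k < e j} := by
  have h : {k | e k < e j + 1} = insert j {k | e k < e j} := by
    ext k
    rw [mem_ofPred_eq, Order.lt_add_one_iff, le_iff_eq_or_lt, he.eq_iff]
    rfl
  rw [h, partialSum, iSup_insert]
  rfl

theorem partialSum_lt_of_isSuccLimit {A M J : Type u} [Ring A] [AddCommGroup M] [Module A M]
    (B : J → Submodule A M) (e : J → Ordinal.{u}) {β : Ordinal.{u}} (hβ : Order.IsSuccLimit β) :
    partialSum B {k | e k < β} = ⨆ α : Iio β, partialSum B {k | e k < α.1} := by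
  refine le_antisymm (iSup₂_le fun j hj => ?_) (iSup_le fun α => partialSum_mono ?_)
  · refine le_trans ?_ (le_iSup (fun α : Iio β => partialSum B {k | e k < α.1})
      ⟨Order.succ (e j), hβ.succ_lt hj⟩)
    exact le_partialSum (show j ∈ {k | e k < Order.succ (e j)} from Order.lt_succ (e j))
  · intro k (hk : e k < α.1)
    exact hk.trans α.2

/-- `hsurj` excludes constant steps, which would need a zero module in `𝒢`. -/
theorem mem_Filt_of_iSup_eq_top {c : Cardinal.{u}} (hc : ℵ₀ ≤ c) {X : RightMod R} {J : Type u}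
    {B : J → Submodule Rᵐᵒᵖ X} {e : J → Ordinal.{u}} (hinj : Function.Injective e)
    (hlt : ∀ j, e j < c.ord) (hsurj : ∀ o < c.ord, ∃ j, e j = o) (htop : ⨆ j, B j = ⊤)
    (hq : ∀ j, HasQuotientIn 𝒢 (B j) (partialSum B {k | e k < e j})) : X ∈ Filt 𝒢 := by
  have hlim : Order.IsSuccLimit c.ord := isSuccLimit_ord hc
  refine ⟨c, fun o => partialSum B {k | e k < o}, ?_, ?_, ?_, ?_, ?_⟩
  · simp [partialSum]
  · exact fun α β h _ => partialSum_mono fun k (hk : e k < α) => hk.trans_le h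
  · exact fun β hβ _ => partialSum_lt_of_isSuccLimit B e hβ
  · intro α hα
    obtain ⟨j, rfl⟩ := hsurj α ((Order.lt_add_one_iff.2 le_rfl).trans hα)
    rw [partialSum_lt_add_one hinj]
    exact hasQuotientIn_iff.1 (hq j).sup
  · rw [← partialSum_lt_of_isSuccLimit B e hlim, ← htop]
    simp [partialSum, hlt]

theorem mem_Filt_iSup {c : Cardinal.{u}} (hc : ℵ₀ ≤ c) {X : RightMod R} {J : Type u}
    {B : J → Submodule Rᵐᵒᵖ X} {e : J → Ordinal.{u}} (hinj : Function.Injective e)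
    (hlt : ∀ j, e j < c.ord) (hsurj : ∀ o < c.ord, ∃ j, e j = o)
    (hq : ∀ j, HasQuotientIn 𝒢 (B j) (partialSum B {k | e k < e j})) :
    ModuleCat.of Rᵐᵒᵖ (⨆ j, B j : Submodule Rᵐᵒᵖ X) ∈ Filt 𝒢 := by
  set Y : Submodule Rᵐᵒᵖ X := ⨆ j, B j with hY
  have hmap : ∀ j, ((B j).submoduleOf Y).map Y.subtype = B j := fun j =>
    Submodule.map_comap_eq_of_le (by simpa using le_iSup B j)
  refine mem_Filt_of_iSup_eq_top (X := ModuleCat.of Rᵐᵒᵖ Y) (B := fun j => (B j).submoduleOf Y)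
    hc hinj hlt hsurj ?_ fun j => ?_
  · refine Submodule.map_injective_of_injective Y.injective_subtype ?_
    rw [Submodule.map_iSup, Submodule.map_subtype_top, hY]
    exact iSup_congr hmap
  · refine (hq j).comap_subtype (le_iSup B j) fun x => ?_
    have h : (partialSum (fun j => (B j).submoduleOf Y) {k | e k < e j}).map Y.subtype =
        partialSum B {k | e k < e j} := by
      simp only [partialSum, Submodule.map_iSup, hmap]
    rw [← h]
    exact (Y.injective_subtype.mem_set_image (s := SetLike.coe _)).symm

variable {X : RightMod R} {κ c : Cardinal.{u}} {F : Ordinal.{u} → Submodule Rᵐᵒᵖ X}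

theorem IsFiltrationBy.exists_small_generators (hF : IsFiltrationBy 𝒢 X κ F) (hc : ℵ₀ < c)
    (hR : #R < c) (h𝒢 : ∀ N ∈ 𝒢, #N < c) :
    ∃ B : κ.ord.ToType → Submodule Rᵐᵒᵖ X, (∀ i, #(B i) < c) ∧ partialSum B univ = ⊤ ∧
      (ℵ₀ ≤ κ → ∀ i, HasQuotientIn 𝒢 (B i) (partialSum B (Iio i))) := by
  have hR' : #Rᵐᵒᵖ < c := by rwa [← MulOpposite.opEquiv.cardinal_eq]
  have hex : ∀ i : κ.ord.ToType, ∃ B : Submodule Rᵐᵒᵖ X, #B < c ∧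
      (i.toOrd.1 + 1 < κ.ord →
        B ⊔ F i.toOrd = F (i.toOrd + 1) ∧ HasQuotientIn 𝒢 B (F i.toOrd)) := by
    intro i
    by_cases hi : i.toOrd.1 + 1 < κ.ord
    · obtain ⟨B, hB⟩ := HasQuotientIn.exists_small hc hR' h𝒢
        (hF.mono _ _ (Order.le_succ i.toOrd.1) hi) (hasQuotientIn_iff.2 (hF.quotient _ hi))
      exact ⟨B, hB.1, fun _ => hB.2⟩
    -- Only the last index of a finite `κ` lands here; it adds nothing to the union.
    · refine ⟨⊥, ?_, fun h => absurd h hi⟩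
      simpa using one_lt_aleph0.trans hc
  choose B hB hBF using hex
  have hinj : Function.Injective fun i : κ.ord.ToType => i.toOrd.1 :=
    Subtype.val_injective.comp ToType.mk.symm.injective
  have hFB : ∀ o < κ.ord, F o = partialSum B {i | i.toOrd.1 < o} := by
    intro o
    induction o using Ordinal.limitRecOn with
    | zero => simp [hF.zero, partialSum]
    | add_one o ih =>
      intro ho
      have ho' : o < κ.ord := (Order.lt_add_one_iff.2 le_rfl).trans ho
      obtain ⟨i, rfl⟩ : ∃ i : κ.ord.ToType, i.toOrd.1 = o := ⟨ToType.mk ⟨o, ho'⟩, by simp⟩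
      rw [← (hBF i ho).1, ih ho']
      exact (partialSum_lt_add_one hinj i).symm
    | limit o ho ih =>
      intro ho'
      rw [hF.limit o ho ho', partialSum_lt_of_isSuccLimit B _ ho]
      exact iSup_congr fun α => ih α α.2 (lt_trans α.2 ho')
  refine ⟨B, hB, ?_, fun hκ i => ?_⟩
  · rw [eq_top_iff, ← hF.union]
    refine iSup_le fun α => ?_
    rw [hFB α α.2]
    exact partialSum_mono (subset_univ _)
  · have h := (hBF i ((isSuccLimit_ord hκ).succ_lt i.toOrd.2)).2
    rw [hFB _ i.toOrd.2] at h
    have hIio : {k : κ.ord.ToType | k.toOrd.1 < i.toOrd.1} = Iio i := by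
      ext k
      exact ToType.mk.symm.lt_iff_lt
    rwa [hIio] at h

theorem mk_biUnion_le_of_forall_le {α β : Type u} {s : Set α} (t : α → Set β) (hc : ℵ₀ ≤ c)
    (hs : #s ≤ c) (ht : ∀ a ∈ s, #(t a) ≤ c) : #(⋃ a ∈ s, t a) ≤ c := by
  refine (mk_biUnion_le t s).trans ((mul_le_mul' hs (ciSup_le' fun a => ?_)).trans
    (mul_eq_self hc).le)
  exact ht a.1 a.2

theorem exists_filtered_submodule (hX : X ∈ Filt 𝒢) (hc : c.IsRegular) (hc' : ℵ₀ < c)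
    (hR : #R < c) (h𝒢 : ∀ N ∈ 𝒢, #N < c) {s : Set X} (hs : #s < c) :
    ∃ Y ∈ Filt 𝒢, ∃ g : Y →ₗ[Rᵐᵒᵖ] X, Function.Injective g ∧ s ⊆ range g ∧
      ∃ t : Set Y, #t ≤ c ∧ Submodule.span Rᵐᵒᵖ t = ⊤ := by
  obtain ⟨κ, F, hF⟩ := id hX
  obtain ⟨B, hB, htop, hq⟩ := hF.exists_small_generators hc' hR h𝒢
  rcases le_or_gt κ c with hκ | hκ
  -- For `κ ≤ c`, the module `X` itself has few enough generators.
  · refine ⟨X, hX, LinearMap.id, Function.injective_id, by simp,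
      ⋃ i ∈ Set.univ, (B i : Set X), mk_biUnion_le_of_forall_le _ hc.aleph0_le ?_ fun i _ => (hB i).le, ?_⟩
    · simpa using hκ
    · rw [eq_top_iff, ← htop]
      exact iSup₂_le fun i hi x hx => Submodule.subset_span (mem_biUnion hi hx)
  have hq := hq (hc'.le.trans hκ.le)
  choose S hSi hS hBS using fun i => exists_small_of_subset_partialSum (B := B) hc
    (D := Iio i) (s := (B i ⊓ partialSum B (Iio i) : Submodule Rᵐᵒᵖ X))
    ((mk_le_mk_of_subset inter_subset_left).trans_lt (hB i)) inter_subset_right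
  obtain ⟨T, -, hT, hsT⟩ := exists_small_of_subset_partialSum (B := B) (D := univ) hc hs
    (by rw [htop]; exact subset_univ _)
  obtain ⟨ι⟩ : Nonempty (c.ord.ToType ≤i κ.ord.ToType) :=
    type_le_iff.1 (by simpa only [type_toType] using ord_le_ord.2 hκ.le)
  -- The initial segment `range ι` is closed under `S` and pads `C` to size exactly `c`.
  let C : Set κ.ord.ToType := range ι ∪ ⋃ i ∈ T, reachable S i
  have hCS : ∀ i ∈ C, S i ⊆ C := by
    rintro i (⟨k, rfl⟩ | hi) j hj
    · exact Or.inl (ι.mem_range_of_rel (hSi _ hj))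
    · obtain ⟨k, hk, hik⟩ := mem_iUnion₂.1 hi
      exact Or.inr (mem_biUnion hk (reachable_closed hik hj))
  have hrange : #(range ι) = c := by
    exact (mk_range_eq _ ι.injective).trans (mk_ord_toType c)
  have hC : #C = c := by
    refine le_antisymm ((mk_union_le _ _).trans ?_) ?_
    · refine add_le_of_le hc.aleph0_le hrange.le ?_
      exact mk_biUnion_le_of_forall_le _ hc.aleph0_le hT.le fun i _ => (mk_reachable_lt hc hSi hS i).le
    · exact hrange.ge.trans (mk_le_mk_of_subset subset_union_left)
  obtain ⟨e, hinj, hlt, hsurj, he⟩ := exists_reorder hc (I := C)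
    (S := fun i => Subtype.val ⁻¹' S i.1) (fun i j hj => hSi i.1 hj)
    (fun i => (mk_preimage_of_injective _ _ Subtype.val_injective).trans_lt (hS i.1)) hC
  have hsum : ∀ D : Set C, partialSum (fun i : C => B i) D = partialSum B (Subtype.val '' D) :=
    fun D => by simp only [partialSum, iSup_image]
  have hY : (⨆ i : C, B i) = partialSum B C := by
    rw [partialSum, iSup_subtype']
  refine ⟨_, mem_Filt_iSup (B := fun i : C => B i) hc.aleph0_le hinj hlt hsurj fun i => ?_,
    Submodule.subtype _, Submodule.injective_subtype _, ?_, ?_⟩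
  · rw [hsum]
    -- The new order respects `S`, so its initial segments are closed index sets for the old order.
    have hsub : ∀ j : C, e j ≤ e i → S j ⊆ Subtype.val '' {k : C | e k < e i} ∩ Iio j.1 :=
      fun j hj k hk => ⟨⟨⟨k, hCS j j.2 hk⟩, (he j ⟨k, hCS j j.2 hk⟩ hk).trans_le hj, rfl⟩, hSi _ hk⟩
    refine (hq i).of_closed ?_ ?_ ?_
    · rintro _ ⟨j, hj, rfl⟩
      exact (hBS j).trans (partialSum_mono (hsub j (le_of_lt hj)))
    · rintro ⟨j, hj, hji⟩
      rw [Subtype.ext hji] at hj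
      exact lt_irrefl (e i) hj
    · exact (hBS i).trans (partialSum_mono ((hsub i le_rfl).trans inter_subset_left))
  · intro x hx
    have hxC : x ∈ (⨆ i : C, B i) := by
      rw [hY]
      refine mem_partialSum_of_subset (hsT hx) fun i hi => Or.inr ?_
      exact mem_biUnion hi (self_mem_reachable S i)
    exact ⟨⟨x, hxC⟩, rfl⟩
  · refine ⟨Subtype.val ⁻¹' ⋃ i ∈ C, (B i : Set X), ?_, ?_⟩
    · refine (mk_preimage_of_injective _ _ Subtype.val_injective).trans ?_
      exact mk_biUnion_le_of_forall_le _ hc.aleph0_le hC.le fun i _ => (hB i).le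
    · refine Submodule.map_injective_of_injective (Submodule.injective_subtype _) ?_
      rw [Submodule.map_subtype_top, Submodule.map_span]
      refine le_antisymm (Submodule.span_le.2 ?_) (iSup_le fun i x hx => Submodule.subset_span ?_)
      · rintro _ ⟨x, _, rfl⟩
        exact x.2
      · exact ⟨⟨x, Submodule.mem_iSup_of_mem i hx⟩, mem_biUnion i.2 hx, rfl⟩

end Filtrations

/-! ### The cardinal bound and the preenvelope -/

theorem exists_regular_bound (R : Type u) [Ring R] {𝒢 : Set (RightMod R)} (h𝒢 : Small.{u} 𝒢)
    (M : RightMod R) :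
    ∃ c : Cardinal.{u}, c.IsRegular ∧ ℵ₀ < c ∧ #R < c ∧ #M < c ∧ ∀ N ∈ 𝒢, #N < c := by
  let d : Cardinal.{u} := Cardinal.sum fun N : Shrink.{u} 𝒢 => #((equivShrink 𝒢).symm N).1
  have hle : ∀ x ≤ ℵ₀ + #R + #M + d, x < Order.succ (ℵ₀ + #R + #M + d) :=
    fun x hx => Order.lt_succ_of_le hx
  refine ⟨Order.succ (ℵ₀ + #R + #M + d), isRegular_succ ?_, hle _ ?_, hle _ ?_, hle _ ?_,
    fun N hN => hle _ ?_⟩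
  · rw [add_assoc, add_assoc]
    exact self_le_add_right _ _
  · rw [add_assoc, add_assoc]
    exact self_le_add_right _ _
  · exact (self_le_add_left _ _).trans ((self_le_add_right _ _).trans (self_le_add_right _ _))
  · exact (self_le_add_left _ _).trans (self_le_add_right _ _)
  · refine le_trans ?_ (self_le_add_left _ _)
    have := Cardinal.le_sum (fun N : Shrink.{u} 𝒢 => #((equivShrink 𝒢).symm N).1)
      (equivShrink 𝒢 ⟨N, hN⟩)
    simpa [d] using this

theorem theoremt (R : Type u) [Ring R] (𝒳 : Set (RightMod R))
    (hdec : IsDeconstructible 𝒳) (hprod : IsClosedUnderProducts 𝒳) :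
    IsPreenveloping 𝒳 := by
  intro M
  obtain ⟨𝒢, h𝒢, rfl⟩ := hdec
  obtain ⟨c, hc, hc', hR, hM, hN⟩ := exists_regular_bound R h𝒢 M
  let L := c.ord.ToType →₀ Rᵐᵒᵖ
  -- Kernels in the free module `L` on `c` generators index all filtered modules with at most `c`
  -- generators, up to isomorphism.
  let K := {p : Submodule Rᵐᵒᵖ L // ∃ Y ∈ Filt 𝒢, Nonempty ((L ⧸ p) ≃ₗ[Rᵐᵒᵖ] Y)}
  choose Y hY e using fun p : K => p.2
  let P : (Σ p : K, M →ₗ[Rᵐᵒᵖ] Y p) → RightMod R := fun i => Y i.1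
  let f : M →ₗ[Rᵐᵒᵖ] (∀ i, P i) := LinearMap.pi fun i => i.2
  refine ⟨ModuleCat.of Rᵐᵒᵖ (∀ i, P i), ModuleCat.ofHom f, hprod _ P fun i => hY i.1,
    fun X hX φ => ?_⟩
  obtain ⟨Z, hZ, g, hg, hφg, t, ht, htop⟩ := exists_filtered_submodule hX hc hc' hR hN
    (s := range φ.hom) (mk_range_le.trans_lt hM)
  obtain ⟨ψ, hψ⟩ : ∃ ψ : M →ₗ[Rᵐᵒᵖ] Z, ∀ x, g (ψ x) = φ.hom x := by
    have hmem : ∀ x, φ.hom x ∈ LinearMap.range g := fun x => hφg ⟨x, rfl⟩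
    refine ⟨(LinearEquiv.ofInjective g hg).symm.toLinearMap ∘ₗ φ.hom.codRestrict _ hmem,
      fun x => ?_⟩
    exact congrArg Subtype.val
      ((LinearEquiv.ofInjective g hg).apply_symm_apply (φ.hom.codRestrict _ hmem x))
  obtain ⟨q, hq⟩ : ∃ q : L →ₗ[Rᵐᵒᵖ] Z, Function.Surjective q := by
    obtain ⟨τ⟩ : Nonempty (t ↪ c.ord.ToType) := by
      rwa [← Cardinal.le_def, mk_ord_toType]
    refine ⟨Finsupp.linearCombination Rᵐᵒᵖ (Function.extend τ Subtype.val 0), ?_⟩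
    rw [← LinearMap.range_eq_top, Finsupp.range_linearCombination, eq_top_iff, ← htop]
    refine Submodule.span_mono fun x hx => ⟨τ ⟨x, hx⟩, ?_⟩
    exact τ.injective.extend_apply _ _ _
  let θ : (L ⧸ LinearMap.ker q) ≃ₗ[Rᵐᵒᵖ] Z := q.quotKerEquivOfSurjective hq
  let p : K := ⟨LinearMap.ker q, Z, hZ, ⟨θ⟩⟩
  let ε : Y p ≃ₗ[Rᵐᵒᵖ] Z := (e p).some.symm.trans θ
  refine ⟨ModuleCat.ofHom (g ∘ₗ ε.toLinearMap ∘ₗ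
    LinearMap.proj (⟨p, ε.symm.toLinearMap ∘ₗ ψ⟩ : Σ p : K, M →ₗ[Rᵐᵒᵖ] Y p)), ?_⟩
  ext x
  change g (ε (ε.symm (ψ x))) = φ.hom x
  rw [ε.apply_symm_apply, hψ]
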